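/- Let $n_\mathcal{T},n_\mathcal{V}\ge 1$, $m,T\ge 0$ be integers, $\eta>0$, $\gamma,\kappa\ge 0$, $\Delta\in(0,1)$. For every hyperparameter $\lambda\in\Lambda$ let $\Theta(\lambda)\subset\mathbb{R}^m$ be compact with positive Lebesgue measure, and let $\ell_\mathcal{T}(\theta;z,\lambda)$, $\ell_\mathcal{V}(\theta;z,\lambda)$ be training and validation losses, defined for $\theta\in\mathbb{R}^m$ and $z=(x,y)\in\mathcal{X}\times\mathcal{Y}$ and differentiable in $\theta$. Assume that $\ell_\mathcal{T}$ takes values in $[0,1]$, is measurable in $z$, and is $\gamma$-Lipschitz in $\theta$. Let $\mathcal{D}_\mathcal{T}$ be a probability distribution on $\mathcal{X}\times\mathcal{Y}$, let $S_\mathcal{T}$ consist of $n_\mathcal{T}$ independent samples from $\mathcal{D}_\mathcal{T}$, and let $S_\mathcal{V}$ be a validation set of size $n_\mathcal{V}$, independent of $S_\mathcal{T}$, whose value is fixed. For a non-empty batch $S$ put $\hat R(\theta;S,\lambda)=\frac1{|S|}\sum_{z\in S}\ell(\theta;z,\lambda)$, and put $R_\mathcal{T}(\theta;\mathcal{D}_\mathcal{T},\lambda)=\mathbb{E}_{z\sim\mathcal{D}_\mathcal{T}}\ell_\mathcal{T}(\theta;z,\lambda)$.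 Let $S^{(t)}_\mathcal{T}\subseteq S_\mathcal{T}$, $S^{(t)}_\mathcal{V}\subseteq S_\mathcal{V}$ be the non-empty mini-batches given by a fixed schedule of index sets. Let $p^1(\theta|S,\lambda)\propto e^{-\hat R(\theta;S,\lambda)}$, $p(\theta|S_\mathcal{T},\lambda)\propto e^{-n_\mathcal{T}\hat R_\mathcal{T}(\theta;S_\mathcal{T},\lambda)}$ and $p(\theta|\mathcal{D}_\mathcal{T},\lambda)\propto e^{-n_\mathcal{T}R_\mathcal{T}(\theta;\mathcal{D}_\mathcal{T},\lambda)}$ be densities with respect to Lebesgue measure on $\Theta(\lambda)$; off $\Theta(\lambda)$ the density $p^1$ is continued by the same formula. Let $\nu_t$ be the law of the $t$-th iterate of the Langevin sampler $\theta_0\sim P_0$, $\theta_{t+1}=\theta_t-\eta\nabla_\theta\hat R_\mathcal{T}(\theta_t;S^{(t)}_\mathcal{T},\lambda)+z_t$ with independent $z_t\sim\mathcal{N}(0,\frac{2\eta}{n_\mathcal{T}}\mathbb{I}_m)$, where $P_0$ is a fixed probability distribution on $\mathbb{R}^m$. With $d_{2,\nu}(q,p)=(\mathbb{E}_\nu\|\nabla\log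 q-\nabla\log p\|_2^2)^{1/2}\in[0,\infty]$, define the gradient-incoherence regularizer $$\mathrm{Reg}(\lambda)=\Big(\sum_{t=0}^{T-1}d^2_{2,\nu_t}\big(p^1(\theta|S^{(t)}_\mathcal{T},\lambda),\,p^1(\theta|S^{(t)}_\mathcal{V},\lambda)\big)\Big)^{1/2}$$ and the $\lambda$-independent quantities $$D=\sqrt{\frac{\eta\, n_\mathcal{T}n_\mathcal{V}}{8}},\qquad B=\frac{Tm}{2}\Big(\frac{n_\mathcal{V}}{n_\mathcal{T}}-1-\log\frac{n_\mathcal{V}}{n_\mathcal{T}}\Big),$$ $$C=n_\mathcal{T}\Big(\sqrt{\frac{B+\log(5n_\mathcal{T}/\Delta)}{2n_\mathcal{T}}}+\sqrt{\frac{\log(5n_\mathcal{T}/\Delta)}{2n_\mathcal{T}}}+2\gamma\kappa\Big).$$ Then: (1) For every $\lambda\in\Lambda$, with probability at least $1-\Delta$ over $S_\mathcal{T}$: if the 1-Wasserstein distance between $\nu_T$ and $p(\theta|S_\mathcal{T},\lambda)$ is at most $\kappa$, then $$\mathrm{KL}\big(p(\theta|S_\mathcal{T},\lambda)\,\big\|\,p(\theta|\mathcal{D}_\mathcal{T},\lambda)\big)\le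 D\cdot\mathrm{Reg}(\lambda)+C.$$ (2) Minimizing $\mathrm{Reg}$ is equivalent to minimizing this upper bound: for every training set and every $A\subseteq\Lambda$, a hyperparameter attains the minimum over $A$ of $\mathrm{Reg}(\lambda)$ if and only if it attains the minimum over $A$ of $D\cdot\mathrm{Reg}(\lambda)+C$. -/

import Mathlib

open MeasureTheory ProbabilityTheory InformationTheory
open scoped NNReal ENNReal Gradient

noncomputable section

/-- The Euclidean space `ℝᵐ` that contains the model parameters. -/
abbrev Param (m : ℕ) : Type := EuclideanSpace ℝ (Fin m)

/-- Empirical risk of the parameter `θ` on the mini-batch of the data set `S` with index set `J`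
(the whole data set is `J = Finset.univ`): the average loss over the batch. -/
def empRisk {m n : ℕ} {Z : Type*} (loss : Param m → Z → ℝ) (S : Fin n → Z) (J : Finset (Fin n))
    (θ : Param m) : ℝ :=
  (∑ i ∈ J, loss θ (S i)) / (J.card : ℝ)

/-- Expected (out-of-sample) risk of the parameter `θ` under the data distribution `D`. -/
def expRisk {m : ℕ} {Z : Type*} [MeasurableSpace Z] (loss : Param m → Z → ℝ) (D : Measure Z)
    (θ : Param m) : ℝ :=
  ∫ z, loss θ z ∂D

/-- The Gibbs density `exp (-τ F(θ)) / ∫_Θ exp (-τ F)` for the risk function `F`. It is a density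
on `Θ` with respect to Lebesgue measure; the formula makes sense at every `θ ∈ ℝᵐ`, which is needed
to evaluate the score along sampler iterates, since these are not confined to `Θ`. -/
def gibbsDensity {m : ℕ} (Θ : Set (Param m)) (τ : ℝ) (F : Param m → ℝ) (θ : Param m) : ℝ :=
  Real.exp (-(τ * F θ)) / ∫ u in Θ, Real.exp (-(τ * F u))

/-- The Gibbs distribution on `Θ`: density `gibbsDensity Θ τ F` with respect to Lebesgue measure
on `Θ`. -/
def gibbs {m : ℕ} (Θ : Set (Param m)) (τ : ℝ) (F : Param m → ℝ) : Measure (Param m) :=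
  (volume.restrict Θ).withDensity fun θ => ENNReal.ofReal (gibbsDensity Θ τ F θ)

/-- The law `ν_t` of the `t`-th iterate of the Langevin sampler with constant step size `η`, sample
size `n`, initial law `P₀` and (mini-batch) risk functions `F 0, F 1, …`:
`θ_{t+1} = θ_t - η ∇F_t(θ_t) + z_t` with independent `z_t ∼ N(0, (2η/n) I)`. -/
def langevinLaw {m : ℕ} (P₀ : Measure (Param m)) (η : ℝ) (n : ℕ) (F : ℕ → Param m → ℝ) :
    ℕ → Measure (Param m)
  | 0 => P₀
  | t + 1 =>
      ((langevinLaw P₀ η n F t).prod (stdGaussian (Param m))).map fun p =>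
        p.1 - η • ∇ (F t) p.1 + √(2 * η / n) • p.2

/-- The 1-Wasserstein distance `sup { E_Q f - E_P f : f is 1-Lipschitz }`, with values in `[0, ∞]`.
The test functions are those for which both expectations exist; this is no restriction for laws
with bounded support. -/
def wasserstein1 {m : ℕ} (Q P : Measure (Param m)) : ℝ≥0∞ :=
  ⨆ (f : Param m → ℝ) (_ : LipschitzWith 1 f ∧ Integrable f Q ∧ Integrable f P),
    ENNReal.ofReal (∫ θ, f θ ∂Q - ∫ θ, f θ ∂P)

/-- The `(2, ν)`-Fisher distance `(E_ν ‖∇ log q - ∇ log p‖²)^{1/2}` between the densities `q` and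
`p`, with values in `[0, ∞]`. -/
def fisherDist {m : ℕ} (ν : Measure (Param m)) (q p : Param m → ℝ) : ℝ≥0∞ :=
  (∫⁻ θ, ‖∇ (fun u => Real.log (q u)) θ - ∇ (fun u => Real.log (p u)) θ‖ₑ ^ 2 ∂ν) ^ (1 / 2 : ℝ)

/-- The law `ν_t` of the `t`-th iterate of the Langevin sampler for the training set `S` of size
`n`, which uses the mini-batch with index set `J t` at step `t`. -/
def trainLaw {m n : ℕ} {Z : Type*} (loss : Param m → Z → ℝ) (P₀ : Measure (Param m)) (η : ℝ)
    (J : ℕ → Finset (Fin n)) (S : Fin n → Z) (t : ℕ) : Measure (Param m) :=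
  langevinLaw P₀ η n (fun s => empRisk loss S (J s)) t

/-- The gradient-incoherence regularizer: the square root of the sum over `t < T` of the squared
`(2, ν_t)`-Fisher distances between the Gibbs posteriors with `τ = 1` of the `t`-th training and the
`t`-th validation mini-batch. -/
def incoherence {m nT nV : ℕ} {Z : Type*} (Θ : Set (Param m)) (lossT lossV : Param m → Z → ℝ)
    (P₀ : Measure (Param m)) (η : ℝ) (T : ℕ) (JT : ℕ → Finset (Fin nT)) (JV : ℕ → Finset (Fin nV))
    (ST : Fin nT → Z) (SV : Fin nV → Z) : ℝ≥0∞ :=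
  (∑ t ∈ Finset.range T,
    fisherDist (trainLaw lossT P₀ η JT ST t)
      (gibbsDensity Θ 1 (empRisk lossT ST (JT t)))
      (gibbsDensity Θ 1 (empRisk lossV SV (JV t))) ^ 2) ^ (1 / 2 : ℝ)

/-- The divergence of the posterior for the observed training set from the posterior for the data
distribution `D`: `KL(p(θ|S) ‖ p(θ|D))`, where `p(θ|S) ∝ exp (-n R̂(θ; S))` and
`p(θ|D) ∝ exp (-n R(θ; D))` on `Θ`. -/
def posteriorKL {m n : ℕ} {Z : Type*} [MeasurableSpace Z] (Θ : Set (Param m))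
    (loss : Param m → Z → ℝ) (D : Measure Z) (S : Fin n → Z) : ℝ≥0∞ :=
  klDiv (gibbs Θ n (empRisk loss S Finset.univ)) (gibbs Θ n (expRisk loss D))

/-- The factor `D(η, n_T, n_V)` in front of the regularizer. -/
def boundSlope (η : ℝ) (nT nV : ℕ) : ℝ :=
  √(η * nT * nV / 8)

/-- The total covariance-mismatch term `B(η, n_T, n_V, m)` of `T` steps: `T` times the divergence of
`N(0, (2η/n_T) I_m)` from `N(0, (2η/n_V) I_m)`. -/
def mismatch (T m nT nV : ℕ) : ℝ :=
  T * (m / 2 * ((nV : ℝ) / nT - 1 - Real.log ((nV : ℝ) / nT)))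

/-- The additive term of the bound. It does not involve the hyperparameters or the data. -/
def boundOffset (T m nT nV : ℕ) (Δ γ κ : ℝ) : ℝ :=
  nT * (√((mismatch T m nT nV + Real.log (5 * nT / Δ)) / (2 * nT))
    + √(Real.log (5 * nT / Δ) / (2 * nT)) + 2 * γ * κ)

end

/-! Let `gap` be the expected risk minus the empirical risk. The two posteriors are exponential
tilts of each other with exponent `n_T * gap`, so Jensen applied to the log normaliser gives `KL ≤
n_T (E_{p(S)} gap - E_{p(D)} gap)` (`klDiv_gibbs_le`).

The law `p(D)` does not depend on the sample, so Hoeffding bounds the second average from below. The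
first is moved to the sampler law `ν_T` by Kantorovich-Rubinstein; this costs `2γκ`, because `gap`
is `2γ`-Lipschitz.

The average under `ν_T` is a PAC-Bayes problem. The prior is the Langevin sampler run on the fixed
validation set with noise variance `2η/n_V`, hence independent of the training sample. A
Donsker-Varadhan inequality, proved by induction over the steps, charges each step a Gaussian
divergence: a variance mismatch plus `η n_V / 4` times the mean squared gradient difference. The
latter sum to `Reg²`. Under the prior, Hoeffding's tail yields `E exp (2 n_T gap₊²) ≤ 1 + 2 n_T`,
and Markov's inequality makes this a high-probability bound.

Claim (2) holds because the bound is a strictly increasing affine function of `Reg`. -/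

/-! ### Density and moments of the standard Gaussian. -/

section StdGaussian

variable {E : Type*} [NormedAddCommGroup E] [InnerProductSpace ℝ E] [FiniteDimensional ℝ E]
  [MeasurableSpace E] [BorelSpace E]

lemma integrable_exp_neg_sq_norm_div_two : Integrable fun x : E => Real.exp (-‖x‖ ^ 2 / 2) := by
  have h := (GaussianFourier.integrable_cexp_neg_mul_sq_norm_add (V := E) (b := 1 / 2)
    (by norm_num) 0 0).norm
  refine h.congr (.of_forall fun x => ?_)
  simp only [Complex.norm_exp]
  congr 1
  have : (-(1 / 2 : ℂ) * (‖x‖ : ℂ) ^ 2 + 0 * ((inner ℝ (0 : E) x : ℝ) : ℂ))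
      = ((-‖x‖ ^ 2 / 2 : ℝ) : ℂ) := by push_cast; ring
  rw [this, Complex.ofReal_re]

/-- The standard Gaussian distribution has density proportional to `exp (-‖x‖² / 2)`. -/
lemma stdGaussian_eq_tilted :
    stdGaussian E = (volume : Measure E).tilted fun x => -‖x‖ ^ 2 / 2 := by
  have hint := integrable_exp_neg_sq_norm_div_two (E := E)
  have : IsProbabilityMeasure ((volume : Measure E).tilted fun x => -‖x‖ ^ 2 / 2) :=
    isProbabilityMeasure_tilted hint
  -- Both laws are identified through their characteristic functions, the tilt's being the Gaussian
  -- Fourier integral with `b = 1/2` and linear coefficient `i`.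
  refine Measure.ext_of_charFun (funext fun t => ?_)
  rw [charFun_stdGaussian, charFun_apply, integral_tilted]
  have hZ : ∫ x : E, Real.exp (-‖x‖ ^ 2 / 2) = (2 * Real.pi) ^ (Module.finrank ℝ E / 2 : ℝ) := by
    have := GaussianFourier.integral_rexp_neg_mul_sq_norm (V := E) (b := 1 / 2) (by norm_num)
    rw [show Real.pi / (1 / 2) = 2 * Real.pi by ring] at this
    rw [← this]
    congr 1 with x
    ring_nf
  have hpi : (0 : ℝ) ≤ 2 * Real.pi := by positivity
  have hne : (((2 * Real.pi) ^ (Module.finrank ℝ E / 2 : ℝ) : ℝ) : ℂ) ≠ 0 := by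
    exact_mod_cast (by positivity : (2 * Real.pi) ^ (Module.finrank ℝ E / 2 : ℝ) ≠ 0)
  have hF := GaussianFourier.integral_cexp_neg_mul_sq_norm_add (V := E) (b := 1 / 2)
    (by norm_num) Complex.I t
  have hcongr : ∀ x : E, (Real.exp (-‖x‖ ^ 2 / 2) / ∫ y : E, Real.exp (-‖y‖ ^ 2 / 2)) •
        Complex.exp ((inner ℝ x t : ℝ) * Complex.I)
      = (((2 * Real.pi) ^ (Module.finrank ℝ E / 2 : ℝ) : ℝ) : ℂ)⁻¹ *
        Complex.exp (-(1 / 2 : ℂ) * (‖x‖ : ℂ) ^ 2 + Complex.I * ((inner ℝ t x : ℝ) : ℂ)) := by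
    intro x
    rw [hZ, Complex.real_smul, Complex.ofReal_div, Complex.ofReal_exp, Complex.exp_add,
      real_inner_comm]
    push_cast
    rw [div_eq_inv_mul, mul_assoc]
    ring_nf
  simp_rw [hcongr]
  rw [integral_const_mul, hF]
  have hp : ((Real.pi : ℂ) / (1 / 2)) ^ ((Module.finrank ℝ E : ℂ) / 2)
      = (((2 * Real.pi) ^ (Module.finrank ℝ E / 2 : ℝ) : ℝ) : ℂ) := by
    rw [Complex.ofReal_cpow hpi]
    push_cast
    congr 1
    ring
  rw [hp, ← mul_assoc, inv_mul_cancel₀ hne, one_mul, Complex.I_sq]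
  congr 1
  ring

lemma integrable_stdGaussian_sq_norm : Integrable (fun x : E => ‖x‖ ^ 2) (stdGaussian E) :=
  (IsGaussian.memLp_two_id (μ := stdGaussian E)).integrable_norm_pow (by norm_num)

lemma integral_stdGaussian_inner (d : E) : ∫ x, inner ℝ d x ∂(stdGaussian E) = 0 :=
  integral_strongDual_stdGaussian (innerSL ℝ d)

lemma integrable_stdGaussian_inner (d : E) :
    Integrable (fun x => inner ℝ d x) (stdGaussian E) :=
  (innerSL ℝ d).integrable_comp IsGaussian.integrable_id

lemma integral_stdGaussian_sq_norm :
    ∫ x, ‖x‖ ^ 2 ∂(stdGaussian E) = Module.finrank ℝ E := by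
  let b := stdOrthonormalBasis ℝ E
  have h1 : ∀ x : E, ‖x‖ ^ 2 = ∑ i, (inner ℝ (b i) x : ℝ) ^ 2 := fun x => by
    rw [← b.sum_sq_norm_inner_right x]
    simp
  have hL : ∀ i, MemLp (innerSL ℝ (b i)) 2 (stdGaussian E) := fun i =>
    (innerSL ℝ (b i)).comp_memLp' (IsGaussian.memLp_two_id (μ := stdGaussian E))
  simp_rw [h1]
  rw [integral_finsetSum (f := fun i x => (inner ℝ (b i) x : ℝ) ^ 2) _
    fun i _ => (hL i).integrable_sq]
  have h2 : ∀ i, ∫ x, (inner ℝ (b i) x : ℝ) ^ 2 ∂(stdGaussian E) = 1 := fun i => by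
    have h := variance_dual_stdGaussian (innerSL ℝ (b i))
    rw [variance_of_integral_eq_zero (by fun_prop) (integral_strongDual_stdGaussian _)] at h
    simpa using h
  simp [h2]

end StdGaussian

/-! ### Variational inequalities for log-Laplace transforms. -/

/-- **Jensen's inequality** for the exponential. -/
lemma integral_le_log_integral_exp {α : Type*} [MeasurableSpace α] {μ : Measure α}
    [IsProbabilityMeasure μ] {f : α → ℝ} (hf : Integrable f μ)
    (hef : Integrable (fun x => Real.exp (f x)) μ) :
    ∫ x, f x ∂μ ≤ Real.log (∫ x, Real.exp (f x) ∂μ) := by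
  rw [Real.le_log_iff_exp_le (integral_exp_pos hef)]
  exact convexOn_exp.map_integral_le Real.continuous_exp.continuousOn isClosed_univ
    (by simp) hf hef

lemma integrable_of_abs_le {α : Type*} [MeasurableSpace α] {μ : Measure α} [IsFiniteMeasure μ]
    {f : α → ℝ} (hf : Measurable f) {M : ℝ} (hM : ∀ x, |f x| ≤ M) : Integrable f μ :=
  .of_bound hf.aestronglyMeasurable M (.of_forall hM)

lemma integrable_exp_of_abs_le {α : Type*} [MeasurableSpace α] {μ : Measure α} [IsFiniteMeasure μ]
    {f : α → ℝ} (hf : Measurable f) {M : ℝ} (hM : ∀ x, |f x| ≤ M) :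
    Integrable (fun x => Real.exp (f x)) μ := by
  refine integrable_of_abs_le hf.exp (M := Real.exp M) fun x => ?_
  rw [Real.abs_exp]
  exact Real.exp_le_exp.2 ((le_abs_self _).trans (hM x))

/-- The log-Laplace transform inherits the bound of its exponent, so it can serve as the test
function in the next stage of an induction. -/
lemma abs_log_integral_exp_le {α : Type*} [MeasurableSpace α] {μ : Measure α}
    [IsProbabilityMeasure μ] {f : α → ℝ} (hf : Measurable f) {M : ℝ} (hM : ∀ x, |f x| ≤ M) :
    |Real.log (∫ x, Real.exp (f x) ∂μ)| ≤ M := by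
  have hi := integrable_exp_of_abs_le (μ := μ) hf hM
  have hpos := integral_exp_pos hi
  rw [abs_le]
  constructor
  · rw [Real.le_log_iff_exp_le hpos]
    calc Real.exp (-M) = ∫ _, Real.exp (-M) ∂μ := by simp
      _ ≤ _ := integral_mono (integrable_const _) hi
        fun x => Real.exp_le_exp.2 (abs_le.1 (hM x)).1
  · rw [Real.log_le_iff_le_exp hpos]
    calc ∫ x, Real.exp (f x) ∂μ ≤ ∫ _, Real.exp M ∂μ :=
          integral_mono hi (integrable_const _) (fun x => Real.exp_le_exp.2 (abs_le.1 (hM x)).2)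
      _ = Real.exp M := by simp

/-- The **Donsker-Varadhan inequality** for the isotropic Gaussian laws `N(a, s₁² I)` and
`N(b, s₂² I)`, with the value of their divergence. -/
lemma integral_gaussian_le_log_integral_exp_gaussian {E : Type*} [NormedAddCommGroup E]
    [InnerProductSpace ℝ E] [FiniteDimensional ℝ E] [MeasurableSpace E] [BorelSpace E]
    {g : E → ℝ} (hg : Measurable g) {M : ℝ} (hM : ∀ x, |g x| ≤ M) (a b : E) {s₁ s₂ : ℝ}
    (hs₁ : 0 < s₁) (hs₂ : 0 < s₂) :
    ∫ z, g (a + s₁ • z) ∂(stdGaussian E)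
      ≤ Real.log (∫ z, Real.exp (g (b + s₂ • z)) ∂(stdGaussian E))
        + Module.finrank ℝ E / 2 * (s₁ ^ 2 / s₂ ^ 2 - 1 - Real.log (s₁ ^ 2 / s₂ ^ 2))
        + ‖a - b‖ ^ 2 / (2 * s₂ ^ 2) := by
  set r : ℝ := s₁ / s₂ with hr
  have hr0 : 0 < r := by positivity
  set d : E := s₂⁻¹ • (a - b) with hd
  set k := Module.finrank ℝ E
  set Z : ℝ := ∫ x : E, Real.exp (-‖x‖ ^ 2 / 2) with hZ
  have hq := integrable_exp_neg_sq_norm_div_two (E := E)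
  let H : E → ℝ := fun z => Real.exp (-‖z‖ ^ 2 / 2) * Real.exp (g (b + s₂ • z))
  -- In the coordinate `a + s₁ w = b + s₂ (d + r w)`, this is `g` plus the log of the density ratio
  -- of the two Gaussians, up to the constant `k log r`. That constant returns below as the Jacobian
  -- `r ^ k`; Jensen applied to `f` is then Donsker-Varadhan.
  let f : E → ℝ := fun w => g (a + s₁ • w) - ‖d + r • w‖ ^ 2 / 2 + ‖w‖ ^ 2 / 2
  have hHi : Integrable H := by
    have : Integrable (fun z => Real.exp (g (b + s₂ • z))) (stdGaussian E) :=
      integrable_exp_of_abs_le (hg.comp (by fun_prop)) fun z => hM _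
    rw [stdGaussian_eq_tilted, integrable_tilted_iff hq] at this
    exact this
  have hHf : ∀ w, Real.exp (-‖w‖ ^ 2 / 2) * Real.exp (f w) = H (d + r • w) := fun w => by
    have : b + s₂ • (d + r • w) = a + s₁ • w := by
      rw [smul_add, hd, smul_smul, smul_smul, hr, mul_inv_cancel₀ hs₂.ne',
        mul_div_cancel₀ _ hs₂.ne', one_smul]
      abel
    simp only [H, f, this, ← Real.exp_add]
    congr 1
    ring
  have hcomp : Integrable fun w => H (d + r • w) :=
    (integrable_comp_smul_iff volume (fun u => H (d + u)) hr0.ne').2 (hHi.comp_add_left d)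
  have hef : Integrable (fun w => Real.exp (f w)) (stdGaussian E) := by
    rw [stdGaussian_eq_tilted, integrable_tilted_iff hq]
    exact hcomp.congr (.of_forall fun w => (hHf w).symm)
  have hga : Integrable (fun w => g (a + s₁ • w)) (stdGaussian E) :=
    integrable_of_abs_le (hg.comp (by fun_prop)) fun z => hM _
  have hfeq : f = fun w => g (a + s₁ • w) +
      (-(‖d‖ ^ 2 / 2) + (-r * inner ℝ d w + (1 - r ^ 2) / 2 * ‖w‖ ^ 2)) := by
    funext w
    simp only [f]
    rw [norm_add_sq_real, inner_smul_right, norm_smul r w, mul_pow, Real.norm_eq_abs, sq_abs]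
    ring
  have hi1 := (integrable_stdGaussian_inner d).const_mul (-r)
  have hi2 := (integrable_stdGaussian_sq_norm (E := E)).const_mul ((1 - r ^ 2) / 2)
  have hi3 : Integrable (fun w => -(‖d‖ ^ 2 / 2) + (-r * inner ℝ d w + (1 - r ^ 2) / 2 * ‖w‖ ^ 2))
      (stdGaussian E) := (integrable_const _).add (hi1.add hi2)
  have hi4 : ∫ w, (-r * inner ℝ d w + (1 - r ^ 2) / 2 * ‖w‖ ^ 2) ∂(stdGaussian E)
      = (1 - r ^ 2) / 2 * k := by
    rw [integral_add hi1 hi2, integral_const_mul, integral_const_mul, integral_stdGaussian_inner,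
      integral_stdGaussian_sq_norm, mul_zero, zero_add]
  have hfi : Integrable f (stdGaussian E) := by
    rw [hfeq]
    exact hga.add hi3
  have hfint : ∫ w, f w ∂(stdGaussian E) = ∫ w, g (a + s₁ • w) ∂(stdGaussian E)
      + (-(‖d‖ ^ 2 / 2) + (1 - r ^ 2) / 2 * k) := by
    rw [hfeq, integral_add hga hi3, integral_add (f := fun _ => -(‖d‖ ^ 2 / 2))
      (g := fun w => -r * inner ℝ d w + (1 - r ^ 2) / 2 * ‖w‖ ^ 2)
      (integrable_const _) (hi1.add hi2), hi4]
    simp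
  have hexp : ∫ z, Real.exp (g (b + s₂ • z)) ∂(stdGaussian E)
      = r ^ k * ∫ w, Real.exp (f w) ∂(stdGaussian E) := by
    have e1 : ∫ z, Real.exp (g (b + s₂ • z)) ∂(stdGaussian E) = Z⁻¹ * ∫ z, H z := by
      rw [stdGaussian_eq_tilted, integral_tilted, ← integral_const_mul]
      congr 1 with z
      simp only [H, smul_eq_mul, ← hZ]
      ring
    have e2 : ∫ w, Real.exp (f w) ∂(stdGaussian E) = Z⁻¹ * ∫ w, H (d + r • w) := by
      rw [stdGaussian_eq_tilted, integral_tilted, ← integral_const_mul]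
      congr 1 with z
      rw [← hHf, smul_eq_mul, ← hZ]
      ring
    have e3 : ∫ w, H (d + r • w) = (r ^ k)⁻¹ * ∫ z, H z := by
      rw [Measure.integral_comp_smul volume (fun u => H (d + u)) r,
        integral_add_left_eq_self H d, smul_eq_mul, abs_of_pos (by positivity)]
    rw [e1, e2, e3]
    field_simp
  have hJ := integral_le_log_integral_exp hfi hef
  rw [hexp, Real.log_mul (by positivity) (integral_exp_pos hef).ne', Real.log_pow]
  have hr2 : s₁ ^ 2 / s₂ ^ 2 = r ^ 2 := by rw [hr, div_pow]
  have hd2 : ‖a - b‖ ^ 2 / (2 * s₂ ^ 2) = ‖d‖ ^ 2 / 2 := by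
    rw [hd, norm_smul, Real.norm_of_nonneg (by positivity)]
    field_simp
  rw [hr2, hd2, Real.log_pow]
  rw [hfint] at hJ
  push_cast
  linarith

/-! ### Comparison of two Langevin samplers. -/

lemma measurable_gradient {m : ℕ} (f : Param m → ℝ) : Measurable (∇ f) :=
  (InnerProductSpace.toDual ℝ (Param m)).symm.continuous.measurable.comp (measurable_fderiv ℝ f)

section Langevin

variable {m : ℕ} (P₀ : Measure (Param m)) [IsProbabilityMeasure P₀] (η : ℝ)

lemma measurable_langevin_step (n : ℕ) (f : Param m → ℝ) :
    Measurable fun p : Param m × Param m => p.1 - η • ∇ f p.1 + √(2 * η / n) • p.2 :=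
  (measurable_fst.sub (((measurable_gradient f).comp measurable_fst).const_smul η)).add
    (measurable_snd.const_smul √(2 * η / n))

instance isProbabilityMeasure_langevinLaw (n : ℕ) (F : ℕ → Param m → ℝ) (t : ℕ) :
    IsProbabilityMeasure (langevinLaw P₀ η n F t) := by
  induction t with
  | zero => rw [langevinLaw]; infer_instance
  | succ t ih =>
    rw [langevinLaw]
    exact Measure.isProbabilityMeasure_map (measurable_langevin_step η n (F t)).aemeasurable

lemma integral_langevinLaw_succ (n : ℕ) (F : ℕ → Param m → ℝ) (t : ℕ) {g : Param m → ℝ}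
    (hg : Measurable g) {M : ℝ} (hM : ∀ x, |g x| ≤ M) :
    ∫ θ, g θ ∂(langevinLaw P₀ η n F (t + 1))
      = ∫ θ, ∫ z, g (θ - η • ∇ (F t) θ + √(2 * η / n) • z) ∂(stdGaussian (Param m))
          ∂(langevinLaw P₀ η n F t) := by
  have hs := measurable_langevin_step η n (F t)
  rw [langevinLaw, integral_map hs.aemeasurable hg.aestronglyMeasurable, integral_prod]
  exact integrable_of_abs_le (hg.comp hs) fun _ => hM _

/-- A **Donsker-Varadhan inequality** for the laws of two Langevin samplers with common initial law
and step size, with different risks and sample sizes. -/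
lemma integral_langevinLaw_le_log_integral_exp {η : ℝ} (hη : 0 < η) {n k : ℕ} (hn : 0 < n)
    (hk : 0 < k) (F G : ℕ → Param m → ℝ) (t : ℕ)
    (hFG : ∀ s < t, Integrable (fun θ => ‖∇ (F s) θ - ∇ (G s) θ‖ ^ 2) (langevinLaw P₀ η n F s))
    {g : Param m → ℝ} (hg : Measurable g) {M : ℝ} (hM : ∀ x, |g x| ≤ M) :
    ∫ θ, g θ ∂(langevinLaw P₀ η n F t)
      ≤ Real.log (∫ θ, Real.exp (g θ) ∂(langevinLaw P₀ η k G t)) + mismatch t m n k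
        + η * k / 4 * ∑ s ∈ Finset.range t,
            ∫ θ, ‖∇ (F s) θ - ∇ (G s) θ‖ ^ 2 ∂(langevinLaw P₀ η n F s) := by
  have hn' : (0 : ℝ) < n := Nat.cast_pos.2 hn
  have hk' : (0 : ℝ) < k := Nat.cast_pos.2 hk
  induction t generalizing g with
  | zero =>
    have := integral_le_log_integral_exp (μ := P₀) (integrable_of_abs_le hg hM)
      (integrable_exp_of_abs_le hg hM)
    simpa [langevinLaw, mismatch] using this
  | succ t ih =>
    -- `exp h` is the conditional expectation of `exp g` over the last step of the `G`-chain, so the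
    -- tower property gives `hexp`. The induction hypothesis is used for `h` in place of `g`, hence
    -- the generalization over `g`.
    set h : Param m → ℝ := fun θ => Real.log
      (∫ z, Real.exp (g (θ - η • ∇ (G t) θ + √(2 * η / k) • z)) ∂(stdGaussian (Param m))) with hh
    have hsF := measurable_langevin_step (m := m) η n (F t)
    have hsG := measurable_langevin_step (m := m) η k (G t)
    have hhm : Measurable h :=
      Real.measurable_log.comp
        (hg.comp hsG).exp.stronglyMeasurable.integral_prod_right.measurable
    have hhM : ∀ θ, |h θ| ≤ M := fun θ =>
      abs_log_integral_exp_le (hg.comp (by fun_prop)) fun z => hM _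
    have hexp : ∫ θ, Real.exp (h θ) ∂(langevinLaw P₀ η k G t)
        = ∫ θ, Real.exp (g θ) ∂(langevinLaw P₀ η k G (t + 1)) := by
      rw [integral_langevinLaw_succ P₀ η k G t hg.exp (M := Real.exp M) fun x => by
        rw [Real.abs_exp]
        exact Real.exp_le_exp.2 ((le_abs_self _).trans (hM x))]
      congr 1 with θ
      refine Real.exp_log (integral_exp_pos ?_)
      exact integrable_exp_of_abs_le (hg.comp (by fun_prop)) fun z => hM _
    have IH := ih (fun s hs => hFG s (hs.trans t.lt_succ_self)) hhm hhM
    rw [hexp] at IH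
    set c : ℝ := m / 2 * ((k : ℝ) / n - 1 - Real.log ((k : ℝ) / n)) with hc
    -- One step from a common point `θ`: the variance ratio is `k / n`, and the drift term is `η²
    -- ‖·‖² / (2 · 2η/k) = (η k / 4) ‖·‖²`.
    have hpt : ∀ θ, ∫ z, g (θ - η • ∇ (F t) θ + √(2 * η / n) • z) ∂(stdGaussian (Param m))
        ≤ h θ + (c + η * k / 4 * ‖∇ (F t) θ - ∇ (G t) θ‖ ^ 2) := fun θ => by
      have key := integral_gaussian_le_log_integral_exp_gaussian hg hM (θ - η • ∇ (F t) θ)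
        (θ - η • ∇ (G t) θ) (s₁ := √(2 * η / n)) (s₂ := √(2 * η / k)) (by positivity)
        (by positivity)
      rw [Real.sq_sqrt (by positivity), Real.sq_sqrt (by positivity), sub_sub_sub_cancel_left,
        ← smul_sub, norm_smul, Real.norm_of_nonneg hη.le, mul_pow, norm_sub_rev,
        finrank_euclideanSpace_fin,
        show 2 * η / n / (2 * η / k) = (k : ℝ) / n by field_simp] at key
      rw [← add_assoc]
      convert key using 2
      field_simp
      ring
    have hi := (hFG t t.lt_succ_self).const_mul (η * k / 4)
    have hi' : Integrable (fun θ => c + η * k / 4 * ‖∇ (F t) θ - ∇ (G t) θ‖ ^ 2)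
      (langevinLaw P₀ η n F t) := (integrable_const c).add hi
    have hhi : Integrable h (langevinLaw P₀ η n F t) := integrable_of_abs_le hhm hhM
    have hin : Integrable (fun θ => ∫ z, g (θ - η • ∇ (F t) θ + √(2 * η / n) • z)
        ∂(stdGaussian (Param m))) (langevinLaw P₀ η n F t) :=
      (integrable_of_abs_le (μ := (langevinLaw P₀ η n F t).prod (stdGaussian (Param m)))
        (hg.comp hsF) fun _ => hM _).integral_prod_left
    rw [integral_langevinLaw_succ P₀ η n F t hg hM, Finset.sum_range_succ]
    calc _ ≤ ∫ θ, (h θ + (c + η * k / 4 * ‖∇ (F t) θ - ∇ (G t) θ‖ ^ 2))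
          ∂(langevinLaw P₀ η n F t) := integral_mono hin (hhi.add hi') hpt
      _ = ∫ θ, h θ ∂(langevinLaw P₀ η n F t) + (c + η * k / 4 *
          ∫ θ, ‖∇ (F t) θ - ∇ (G t) θ‖ ^ 2 ∂(langevinLaw P₀ η n F t)) := by
        rw [integral_add hhi hi', integral_add (integrable_const c) hi,
          integral_const_mul (η * k / 4), integral_const,
          probReal_univ, one_smul]
      _ ≤ _ := by
        have : mismatch (t + 1) m n k = mismatch t m n k + c := by
          simp only [mismatch, hc]
          push_cast
          ring
        rw [this]
        linarith

end Langevin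

/-! ### Hoeffding's inequality and the PAC-Bayes exponential moment. -/

section Concentration

variable {Z : Type*} [MeasurableSpace Z] (P : Measure Z) [IsProbabilityMeasure P] {n : ℕ}

/-- **Hoeffding's inequality** for the average of a `[0, 1]`-valued function over an i.i.d.
sample. -/
lemma measure_pi_le_integral_sub_average_le (hn : 0 < n) {f : Z → ℝ} (hf : Measurable f)
    (hf01 : ∀ z, f z ∈ Set.Icc (0 : ℝ) 1) {ε : ℝ} (hε : 0 ≤ ε) :
    (Measure.pi fun _ : Fin n => P) {S | ε ≤ ∫ z, f z ∂P - (∑ i, f (S i)) / n}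
      ≤ ENNReal.ofReal (Real.exp (-(2 * n * ε ^ 2))) := by
  have hn' : (0 : ℝ) < n := Nat.cast_pos.2 hn
  have hneg : HasSubgaussianMGF (fun z => ∫ z, f z ∂P - f z) ((‖(1 : ℝ) - 0‖₊ / 2) ^ 2) P := by
    have h := (hasSubgaussianMGF_of_mem_Icc hf.aemeasurable (.of_forall hf01) (μ := P)).neg
    exact h.congr (.of_forall fun z => by simp)
  have hX : ∀ i : Fin n, HasSubgaussianMGF (fun S : Fin n → Z => ∫ z, f z ∂P - f (S i))
      ((‖(1 : ℝ) - 0‖₊ / 2) ^ 2) (Measure.pi fun _ : Fin n => P) := fun i =>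
    HasSubgaussianMGF.of_map (Y := fun S : Fin n → Z => S i)
      (X := fun z => ∫ z, f z ∂P - f z) (measurable_pi_apply i).aemeasurable
      (by rwa [(measurePreserving_eval (fun _ : Fin n => P) i).map_eq])
  have hind : iIndepFun (fun (i : Fin n) (S : Fin n → Z) => ∫ z, f z ∂P - f (S i))
      (Measure.pi fun _ : Fin n => P) :=
    iIndepFun_pi (μ := fun _ : Fin n => P) (X := fun _ z => ∫ z, f z ∂P - f z)
      fun _ => (measurable_const.sub hf).aemeasurable
  have h := HasSubgaussianMGF.measure_sum_ge_le_of_iIndepFun hind (s := Finset.univ)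
    (fun i _ => hX i) (ε := n * ε) (by positivity)
  have hset : {S : Fin n → Z | ε ≤ ∫ z, f z ∂P - (∑ i, f (S i)) / n}
      = {S | n * ε ≤ ∑ i, (∫ z, f z ∂P - f (S i))} := by
    ext S
    simp only [Set.mem_ofPred_eq, Finset.sum_sub_distrib, Finset.sum_const, Finset.card_univ,
      Fintype.card_fin, nsmul_eq_mul]
    rw [← mul_le_mul_iff_right₀ hn', mul_sub, mul_div_cancel₀ _ hn'.ne']
  rw [hset, ← ofReal_measureReal]
  refine ENNReal.ofReal_le_ofReal (h.trans_eq ?_)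
  congr 1
  simp
  field_simp

lemma average_mem_Icc (hn : 0 < n) {f : Fin n → ℝ} (hf : ∀ i, f i ∈ Set.Icc (0 : ℝ) 1) :
    (∑ i, f i) / n ∈ Set.Icc (0 : ℝ) 1 := by
  have hn' : (0 : ℝ) < n := Nat.cast_pos.2 hn
  refine ⟨div_nonneg (Finset.sum_nonneg fun i _ => (hf i).1) hn'.le, ?_⟩
  rw [div_le_one hn']
  calc ∑ i, f i ≤ ∑ _i : Fin n, (1 : ℝ) := Finset.sum_le_sum fun i _ => (hf i).2
    _ = n := by simp

lemma integral_mem_Icc {α : Type*} [MeasurableSpace α] (μ : Measure α) [IsProbabilityMeasure μ]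
    {f : α → ℝ} (hf : ∀ z, f z ∈ Set.Icc (0 : ℝ) 1) : ∫ z, f z ∂μ ∈ Set.Icc (0 : ℝ) 1 := by
  refine ⟨integral_nonneg fun z => (hf z).1, ?_⟩
  calc ∫ z, f z ∂μ ≤ ∫ _, (1 : ℝ) ∂μ := integral_mono_of_nonneg (.of_forall fun z => (hf z).1)
        (integrable_const _) (.of_forall fun z => (hf z).2)
    _ = 1 := by simp

/-- The exponential moment of the squared positive part of the generalization gap. -/
lemma lintegral_exp_sq_gap_le (hn : 0 < n) {f : Z → ℝ} (hf : Measurable f)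
    (hf01 : ∀ z, f z ∈ Set.Icc (0 : ℝ) 1) :
    ∫⁻ S, ENNReal.ofReal (Real.exp (2 * n * max (∫ z, f z ∂P - (∑ i, f (S i)) / n) 0 ^ 2))
        ∂(Measure.pi fun _ : Fin n => P) ≤ ENNReal.ofReal (1 + 2 * n) := by
  have hn' : (0 : ℝ) < n := Nat.cast_pos.2 hn
  set gap : (Fin n → Z) → ℝ := fun S => ∫ z, f z ∂P - (∑ i, f (S i)) / n with hgap
  set X : (Fin n → Z) → ℝ := fun S => Real.exp (2 * n * max (gap S) 0 ^ 2) with hX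
  have hgm : Measurable gap := by fun_prop
  have hXm : Measurable X := by fun_prop
  have hle : ∀ S, max (gap S) 0 ≤ 1 := fun S => by
    have h1 := (integral_mem_Icc P hf01).2
    have h2 := (average_mem_Icc hn fun i => hf01 (S i)).1
    exact max_le (by simp only [hgap]; linarith) zero_le_one
  have hXle : ∀ S, X S ≤ Real.exp (2 * n) := fun S => by
    refine Real.exp_le_exp.2 ?_
    have : max (gap S) 0 ^ 2 ≤ 1 := pow_le_one₀ (le_max_right _ _) (hle S)
    nlinarith
  have h1e : (1 : ℝ) ≤ Real.exp (2 * n) := Real.one_le_exp (by positivity)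
  -- The threshold `√(log t / (2n))` is where Hoeffding's bound equals `1 / t`.
  have htail : ∀ t : ℝ, 1 < t →
      (Measure.pi fun _ : Fin n => P) {S | t < X S} ≤ ENNReal.ofReal t⁻¹ := fun t ht => by
    have hlog := Real.log_pos ht
    have h := measure_pi_le_integral_sub_average_le P hn hf hf01
      (ε := √(Real.log t / (2 * n))) (by positivity)
    rw [Real.sq_sqrt (by positivity), mul_div_cancel₀ _ (by positivity), Real.exp_neg,
      Real.exp_log (by linarith)] at h
    refine (measure_mono fun S hS => ?_).trans h
    have h2 : Real.log t < 2 * n * max (gap S) 0 ^ 2 :=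
      (Real.log_lt_iff_lt_exp (by linarith)).2 hS
    have h3 : √(Real.log t / (2 * n)) < max (gap S) 0 := by
      rw [Real.sqrt_lt' (lt_of_le_of_ne (le_max_right _ _) fun h0 => ?_),
        div_lt_iff₀ (by positivity)]
      · linarith
      · rw [← h0] at h2
        norm_num at h2
        linarith
    rcases lt_max_iff.1 h3 with h4 | h4
    · exact h4.le
    · exact absurd h4 (not_lt.2 (Real.sqrt_nonneg _))
  -- Layer cake. Levels below `1` contribute at most `1`, the tail `1 / t` integrates to `2n` on
  -- `(1, exp (2n)]`, and higher levels are never reached since the gap is at most `1`. Without this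
  -- cap, `∫ 1/t` would diverge.
  rw [lintegral_eq_lintegral_meas_lt _ (.of_forall fun S => (Real.exp_pos _).le) hXm.aemeasurable]
  have hunion : Set.Ioi (0 : ℝ) ⊆ Set.Ioc 0 1 ∪ (Set.Ioc 1 (Real.exp (2 * n)) ∪
      Set.Ioi (Real.exp (2 * n))) := fun t ht => by
    rcases le_or_gt t 1 with h | h
    · exact Or.inl ⟨ht, h⟩
    · rcases le_or_gt t (Real.exp (2 * n)) with h' | h'
      · exact Or.inr (Or.inl ⟨h, h'⟩)
      · exact Or.inr (Or.inr h')
  calc _ ≤ ∫⁻ t in Set.Ioc 0 1 ∪ (Set.Ioc 1 (Real.exp (2 * n)) ∪ Set.Ioi (Real.exp (2 * n))),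
          (Measure.pi fun _ : Fin n => P) {S | t < X S} := lintegral_mono_set hunion
    _ ≤ (∫⁻ t in Set.Ioc 0 1, (Measure.pi fun _ : Fin n => P) {S | t < X S})
        + ((∫⁻ t in Set.Ioc 1 (Real.exp (2 * n)), (Measure.pi fun _ : Fin n => P) {S | t < X S})
        + ∫⁻ t in Set.Ioi (Real.exp (2 * n)), (Measure.pi fun _ : Fin n => P) {S | t < X S}) :=
      (lintegral_union_le _ _ _).trans (by gcongr; exact lintegral_union_le _ _ _)
    _ ≤ 1 + (ENNReal.ofReal (2 * n) + 0) := by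
      gcongr
      · calc _ ≤ ∫⁻ _ in Set.Ioc (0 : ℝ) 1, 1 := lintegral_mono fun t => prob_le_one
          _ = 1 := by simp
      · calc _ ≤ ∫⁻ t in Set.Ioc 1 (Real.exp (2 * n)), ENNReal.ofReal t⁻¹ :=
              setLIntegral_mono' measurableSet_Ioc fun t ht => htail t ht.1
          _ = ENNReal.ofReal (2 * n) := by
            rw [← ofReal_integral_eq_lintegral_ofReal, ← intervalIntegral.integral_of_le h1e,
              integral_inv_of_pos one_pos (Real.exp_pos _), div_one, Real.log_exp]
            · rw [← IntegrableOn, ← intervalIntegrable_iff_integrableOn_Ioc_of_le h1e]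
              exact intervalIntegrable_inv_iff.2
                (Or.inr (by rw [Set.uIcc_of_le h1e]; simp))
            · filter_upwards [self_mem_ae_restrict measurableSet_Ioc] with t ht
              exact inv_nonneg.2 (zero_le_one.trans ht.1.le)
      · rw [setLIntegral_congr_fun (g := fun _ => 0) measurableSet_Ioi]
        · simp
        · intro t ht
          have : {S | t < X S} = ∅ := Set.eq_empty_of_forall_notMem fun S hS =>
            (lt_irrefl t) (hS.trans_le ((hXle S).trans (le_of_lt ht)))
          simp [this]
    _ = ENNReal.ofReal (1 + 2 * n) := by
      rw [add_zero, ENNReal.ofReal_add zero_le_one (by positivity), ENNReal.ofReal_one]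

/-- The random variable of the **PAC-Bayes** argument: the prior average of the exponential of the
squared positive gap is large with small probability over the sample. -/
lemma measure_pi_lintegral_exp_sq_gap_ge_le (hn : 0 < n) {Θ : Type*} [MeasurableSpace Θ]
    (π : Measure Θ) [IsProbabilityMeasure π] {f : Θ → Z → ℝ}
    (hf : Measurable (Function.uncurry f)) (hf01 : ∀ θ z, f θ z ∈ Set.Icc (0 : ℝ) 1) {c : ℝ}
    (hc : 0 < c) :
    (Measure.pi fun _ : Fin n => P) {S | ENNReal.ofReal c ≤ ∫⁻ θ, ENNReal.ofReal
        (Real.exp (2 * n * max (∫ z, f θ z ∂P - (∑ i, f θ (S i)) / n) 0 ^ 2)) ∂π}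
      ≤ ENNReal.ofReal ((1 + 2 * n) / c) := by
  have hR : Measurable fun θ => ∫ z, f θ z ∂P :=
    hf.stronglyMeasurable.integral_prod_right.measurable
  have hsum : Measurable fun p : (Fin n → Z) × Θ => ∑ i, f p.2 (p.1 i) :=
    Finset.measurable_sum _ fun i _ =>
      hf.comp (measurable_snd.prodMk ((measurable_pi_apply i).comp measurable_fst))
  have hm : Measurable fun p : (Fin n → Z) × Θ => ENNReal.ofReal
      (Real.exp (2 * n * max (∫ z, f p.2 z ∂P - (∑ i, f p.2 (p.1 i)) / n) 0 ^ 2)) :=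
    (((((hR.comp measurable_snd).sub (hsum.div_const _)).max measurable_const).pow_const
      2).const_mul _).exp.ennreal_ofReal
  refine (meas_ge_le_lintegral_div hm.lintegral_prod_right'.aemeasurable
    (by simpa using hc) ENNReal.ofReal_ne_top).trans ?_
  rw [ENNReal.ofReal_div_of_pos hc]
  gcongr
  -- Tonelli applies because `π` is the same for all samples; the moment bound is then used at each
  -- fixed `θ`.
  rw [lintegral_lintegral_swap hm.aemeasurable]
  calc _ ≤ ∫⁻ _, ENNReal.ofReal (1 + 2 * n) ∂π := lintegral_mono fun θ =>
        lintegral_exp_sq_gap_le P hn (hf.comp measurable_prodMk_left) (hf01 θ)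
    _ = _ := by simp

end Concentration

/-! ### Gibbs measures as exponential tilts. -/

/-- The divergence of an exponential tilt from the base measure, bounded by the difference of the
two averages of the exponent. -/
lemma klDiv_tilted_le {α : Type*} [MeasurableSpace α] {μ : Measure α} [IsProbabilityMeasure μ]
    {f : α → ℝ} (hf : Integrable f μ) (hef : Integrable (fun x => Real.exp (f x)) μ)
    (hft : Integrable f (μ.tilted f)) :
    klDiv (μ.tilted f) μ ≤ ENNReal.ofReal (∫ x, f x ∂(μ.tilted f) - ∫ x, f x ∂μ) := by
  have : IsProbabilityMeasure (μ.tilted f) := isProbabilityMeasure_tilted hef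
  have hac := tilted_absolutelyContinuous μ f
  have hllr : llr (μ.tilted f) μ =ᵐ[μ.tilted f]
      fun x => f x - Real.log (∫ x, Real.exp (f x) ∂μ) :=
    hac.ae_le (log_rnDeriv_tilted_left_self hef)
  rw [klDiv_of_ac_of_integrable hac ((hft.sub (integrable_const _)).congr hllr.symm),
    integral_congr_ae hllr, integral_sub hft (integrable_const _)]
  -- The divergence equals the tilted average of `f` minus `log ∫ exp f ∂μ`, and Jensen bounds that
  -- logarithm below by `∫ f ∂μ`.
  refine ENNReal.ofReal_le_ofReal ?_
  have := integral_le_log_integral_exp hf hef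
  simp only [integral_const, probReal_univ, one_smul]
  linarith

section Gibbs

variable {m : ℕ} {Θ : Set (Param m)} (hΘ : IsCompact Θ) (hpos : 0 < volume Θ) (τ : ℝ)
  {F G g : Param m → ℝ}

include hΘ in
lemma integrable_exp_restrict (hF : Continuous F) :
    Integrable (fun θ => Real.exp (-(τ * F θ))) (volume.restrict Θ) :=
  (Continuous.continuousOn (by fun_prop)).integrableOn_compact hΘ

include hΘ hpos in
lemma isProbabilityMeasure_gibbs (hF : Continuous F) : IsProbabilityMeasure (gibbs Θ τ F) := by
  have : NeZero (volume.restrict Θ) := ⟨by simpa using hpos.ne'⟩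
  exact isProbabilityMeasure_tilted (integrable_exp_restrict hΘ τ hF)

include hΘ hpos in
lemma integral_exp_restrict_pos (hF : Continuous F) :
    0 < ∫ θ in Θ, Real.exp (-(τ * F θ)) := by
  have : NeZero (volume.restrict Θ) := ⟨by simpa using hpos.ne'⟩
  exact integral_exp_pos (integrable_exp_restrict hΘ τ hF)

include hΘ in
lemma integrable_gibbs (hF : Continuous F) (hg : Continuous g) : Integrable g (gibbs Θ τ F) := by
  refine (integrable_tilted_iff (integrable_exp_restrict hΘ τ hF) g).2 ?_
  exact (Continuous.continuousOn (by fun_prop)).integrableOn_compact hΘ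

-- Successive tilts add their exponents, and `-τG + τ(G - F) = -τF`. `gibbs` itself unfolds to a
-- tilt of the restricted Lebesgue measure.
include hΘ in
lemma gibbs_eq_tilted_gibbs (hG : Continuous G) :
    gibbs Θ τ F = (gibbs Θ τ G).tilted fun θ => τ * (G θ - F θ) := by
  have h := tilted_tilted (integrable_exp_restrict hΘ τ hG) fun θ => τ * (G θ - F θ)
  refine Eq.trans ?_ h.symm
  change (volume.restrict Θ).tilted _ = _
  congr 1
  funext θ
  simp only [Pi.add_apply]
  ring

-- The right side is the symmetrized divergence, in which the normalising constants cancel; only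
-- averages of the risk difference remain to be controlled.
include hΘ hpos in
lemma klDiv_gibbs_le (hF : Continuous F) (hG : Continuous G) :
    klDiv (gibbs Θ τ F) (gibbs Θ τ G) ≤ ENNReal.ofReal
      (τ * (∫ θ, (G θ - F θ) ∂(gibbs Θ τ F) - ∫ θ, (G θ - F θ) ∂(gibbs Θ τ G))) := by
  have := isProbabilityMeasure_gibbs hΘ hpos τ hG
  have h := klDiv_tilted_le (μ := gibbs Θ τ G) (f := fun θ => τ * (G θ - F θ))
    (integrable_gibbs hΘ τ hG (by fun_prop)) (integrable_gibbs hΘ τ hG (by fun_prop))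
    (by
      rw [← gibbs_eq_tilted_gibbs hΘ τ hG]
      exact integrable_gibbs hΘ τ hF (by fun_prop))
  rwa [← gibbs_eq_tilted_gibbs hΘ τ hG, integral_const_mul, integral_const_mul, ← mul_sub] at h

-- The normaliser is constant in `θ`, so the score is minus the risk gradient on all of `ℝᵐ`, also
-- off `Θ`. This turns Fisher distances into gradient differences.
include hΘ hpos in
lemma gradient_log_gibbsDensity (hF : Continuous F) (θ : Param m) :
    ∇ (fun u => Real.log (gibbsDensity Θ 1 F u)) θ = -∇ F θ := by
  have hZ := integral_exp_restrict_pos hΘ hpos 1 hF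
  have : (fun u => Real.log (gibbsDensity Θ 1 F u))
      = fun u => -F u - Real.log (∫ θ in Θ, Real.exp (-(1 * F θ))) := by
    funext u
    rw [gibbsDensity, Real.log_div (Real.exp_pos _).ne' hZ.ne', Real.log_exp, one_mul]
  rw [this]
  simp only [gradient, fderiv_sub_const, fderiv_fun_neg, map_neg]

include hΘ hpos in
lemma fisherDist_gibbsDensity_sq (ν : Measure (Param m)) (hF : Continuous F) (hG : Continuous G) :
    fisherDist ν (gibbsDensity Θ 1 F) (gibbsDensity Θ 1 G) ^ 2
      = ∫⁻ θ, ENNReal.ofReal (‖∇ F θ - ∇ G θ‖ ^ 2) ∂ν := by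
  rw [fisherDist, ← ENNReal.rpow_natCast, ← ENNReal.rpow_mul, Nat.cast_ofNat,
    one_div_mul_cancel two_ne_zero, ENNReal.rpow_one]
  refine lintegral_congr fun θ => ?_
  rw [gradient_log_gibbsDensity hΘ hpos hF, gradient_log_gibbsDensity hΘ hpos hG,
    neg_sub_neg, ← ofReal_norm, norm_sub_rev, ENNReal.ofReal_pow (norm_nonneg _)]

end Gibbs

/-! ### Transport and regularity of the risks. -/

/-- The **Kantorovich-Rubinstein** bound for a Lipschitz function. -/
lemma integral_le_add_of_wasserstein1_le {m : ℕ} {Q P : Measure (Param m)}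
    [IsProbabilityMeasure Q] [IsProbabilityMeasure P] {κ K : ℝ≥0} (hW : wasserstein1 Q P ≤ κ)
    {f : Param m → ℝ} (hf : LipschitzWith K f) (hQ : Integrable f Q) (hP : Integrable f P) :
    ∫ θ, f θ ∂P ≤ ∫ θ, f θ ∂Q + K * κ := by
  rcases eq_or_ne K 0 with rfl | hK
  · have hc : ∀ θ, f θ = f 0 := fun θ => by
      simpa using hf.dist_le_mul θ 0
    simp_rw [hc]
    simp
  · have hK' : (0 : ℝ) < K := NNReal.coe_pos.2 (pos_iff_ne_zero.2 hK)
    -- The sign is reversed because `wasserstein1 Q P` bounds `E_Q - E_P`, whereas `E_P f` is to be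
    -- bounded above.
    have hg : LipschitzWith 1 fun θ => -(f θ / K) := by
      refine LipschitzWith.of_dist_le_mul fun x y => ?_
      rw [dist_neg_neg, Real.dist_eq, ← sub_div, abs_div, abs_of_pos hK', div_le_iff₀ hK',
        NNReal.coe_one, one_mul, mul_comm]
      exact hf.dist_le_mul x y
    have h := (le_iSup₂ (f := fun (f : Param m → ℝ) (_ : LipschitzWith 1 f ∧ Integrable f Q ∧
      Integrable f P) => ENNReal.ofReal (∫ θ, f θ ∂Q - ∫ θ, f θ ∂P)) (fun θ => -(f θ / K))
      ⟨hg, (hQ.div_const _).neg, (hP.div_const _).neg⟩).trans hW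
    rw [← ENNReal.ofReal_coe_nnreal] at h
    replace h := (ENNReal.ofReal_le_ofReal_iff κ.2).1 h
    change _ ≤ (κ : ℝ) at h
    rw [integral_neg, integral_neg,
      integral_div, integral_div, neg_sub_neg, ← sub_div, div_le_iff₀ hK'] at h
    linarith

section Risk

variable {m n : ℕ} {Z : Type*} {loss : Param m → Z → ℝ}

lemma empRisk_univ (S : Fin n → Z) (θ : Param m) :
    empRisk loss S Finset.univ θ = (∑ i, loss θ (S i)) / n := by
  simp [empRisk]

lemma continuous_empRisk (hc : ∀ z, Continuous fun θ => loss θ z) (S : Fin n → Z)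
    (J : Finset (Fin n)) : Continuous (empRisk loss S J) :=
  (continuous_finsetSum _ fun i _ => hc (S i)).div_const _

variable [MeasurableSpace Z] (D : Measure Z) [IsProbabilityMeasure D] {γ : ℝ≥0}

lemma measurable_uncurry_loss (hmeas : ∀ θ, Measurable (loss θ))
    (hLip : ∀ z, LipschitzWith γ fun θ => loss θ z) : Measurable (Function.uncurry loss) :=
  measurable_uncurry_of_continuous_of_measurable (fun z => (hLip z).continuous) hmeas

/-- Each risk is an average of `γ`-Lipschitz losses; the difference doubles the constant, whence the
`2γκ` in the bound. -/
lemma lipschitzWith_expRisk_sub_empRisk (hn : 0 < n) (hmeas : ∀ θ, Measurable (loss θ))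
    (hbdd : ∀ θ z, loss θ z ∈ Set.Icc (0 : ℝ) 1)
    (hLip : ∀ z, LipschitzWith γ fun θ => loss θ z) (S : Fin n → Z) :
    LipschitzWith (2 * γ) fun θ => expRisk loss D θ - empRisk loss S Finset.univ θ := by
  have hn' : (0 : ℝ) < n := Nat.cast_pos.2 hn
  have hi : ∀ θ, Integrable (loss θ) D := fun θ =>
    integrable_of_abs_le (hmeas θ) (M := 1) fun z =>
      abs_le.2 ⟨by linarith [(hbdd θ z).1], (hbdd θ z).2⟩
  have hexp : LipschitzWith γ (expRisk loss D) := by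
    refine LipschitzWith.of_le_add_mul γ fun x y => ?_
    calc expRisk loss D x ≤ ∫ z, (loss y z + γ * dist x y) ∂D :=
          integral_mono (hi x) ((hi y).add (integrable_const _)) fun z => by
            have := (abs_le.1 ((hLip z).dist_le_mul x y)).2
            linarith
      _ = expRisk loss D y + γ * dist x y := by
        rw [integral_add (hi y) (integrable_const _)]
        simp [expRisk]
  have hemp : LipschitzWith γ (empRisk loss S Finset.univ) := by
    refine LipschitzWith.of_le_add_mul γ fun x y => ?_
    rw [empRisk_univ, empRisk_univ, div_add' _ _ _ hn'.ne', div_le_div_iff_of_pos_right hn']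
    calc ∑ i, loss x (S i) ≤ ∑ i, (loss y (S i) + γ * dist x y) :=
          Finset.sum_le_sum fun i _ => by
            have := (abs_le.1 ((hLip (S i)).dist_le_mul x y)).2
            linarith
      _ = _ := by
        rw [Finset.sum_add_distrib]
        simp
        ring
  rw [two_mul]
  exact hexp.sub hemp

lemma continuous_expRisk (hmeas : ∀ θ, Measurable (loss θ))
    (hbdd : ∀ θ z, loss θ z ∈ Set.Icc (0 : ℝ) 1) (hLip : ∀ z, LipschitzWith γ fun θ => loss θ z) :
    Continuous (expRisk loss D) := by
  refine continuous_of_dominated (bound := fun _ => 1) (fun θ => (hmeas θ).aestronglyMeasurable)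
    (fun θ => .of_forall fun z => ?_) (integrable_const _)
    (.of_forall fun z => (hLip z).continuous)
  exact abs_le.2 ⟨by linarith [(hbdd θ z).1], (hbdd θ z).2⟩

/-- The average of the generalization gap with respect to a law that does not depend on the sample
is itself a generalization gap. -/
lemma integral_expRisk_sub_empRisk (μ : Measure (Param m)) [IsProbabilityMeasure μ]
    (hmeas : Measurable (Function.uncurry loss)) (hbdd : ∀ θ z, loss θ z ∈ Set.Icc (0 : ℝ) 1)
    (S : Fin n → Z) :
    ∫ θ, (expRisk loss D θ - empRisk loss S Finset.univ θ) ∂μ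
      = ∫ z, ∫ θ, loss θ z ∂μ ∂D - (∑ i, ∫ θ, loss θ (S i) ∂μ) / n := by
  have habs : ∀ θ z, |loss θ z| ≤ 1 := fun θ z =>
    abs_le.2 ⟨by linarith [(hbdd θ z).1], (hbdd θ z).2⟩
  have hi : Integrable (Function.uncurry loss) (μ.prod D) :=
    integrable_of_abs_le hmeas fun p => habs p.1 p.2
  have his : ∀ i, Integrable (fun θ => loss θ (S i)) μ := fun i =>
    integrable_of_abs_le (hmeas.comp measurable_prodMk_right) fun θ => habs θ (S i)
  simp_rw [empRisk_univ]
  rw [integral_sub (f := expRisk loss D) hi.integral_prod_left ((integrable_finsetSum _ fun i _ => his i).div_const _),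
    integral_div, integral_finsetSum _ fun i _ => his i]
  congr 1
  exact integral_integral_swap hi

end Risk

/-! ### The regularizer and the deterministic bound. -/

/-- A finite gradient incoherence is the square root of a sum of mean squared score differences. -/
lemma incoherence_sq_eq {m nT nV : ℕ} {Z : Type*} {Θ : Set (Param m)}
    (hΘ : IsCompact Θ) (hpos : 0 < volume Θ) {lossT lossV : Param m → Z → ℝ}
    (hT : ∀ z, Continuous fun θ => lossT θ z) (hV : ∀ z, Continuous fun θ => lossV θ z)
    (P₀ : Measure (Param m)) (η : ℝ) (T : ℕ) (JT : ℕ → Finset (Fin nT)) (JV : ℕ → Finset (Fin nV))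
    (ST : Fin nT → Z) (SV : Fin nV → Z)
    (hfin : incoherence Θ lossT lossV P₀ η T JT JV ST SV ≠ ⊤) :
    (∀ t < T, Integrable
      (fun θ => ‖∇ (empRisk lossT ST (JT t)) θ - ∇ (empRisk lossV SV (JV t)) θ‖ ^ 2)
      (trainLaw lossT P₀ η JT ST t)) ∧
    ∑ t ∈ Finset.range T,
        ∫ θ, ‖∇ (empRisk lossT ST (JT t)) θ - ∇ (empRisk lossV SV (JV t)) θ‖ ^ 2
          ∂(trainLaw lossT P₀ η JT ST t)
      = (incoherence Θ lossT lossV P₀ η T JT JV ST SV).toReal ^ 2 := by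
  set c : ℕ → Param m → ℝ := fun t θ =>
    ‖∇ (empRisk lossT ST (JT t)) θ - ∇ (empRisk lossV SV (JV t)) θ‖ ^ 2 with hc
  have hcm : ∀ t, Measurable (c t) := fun t =>
    ((measurable_gradient _).sub (measurable_gradient _)).norm.pow_const 2
  have hc0 : ∀ t θ, 0 ≤ c t θ := fun t θ => sq_nonneg _
  have hsq : incoherence Θ lossT lossV P₀ η T JT JV ST SV ^ 2
      = ∑ t ∈ Finset.range T, ∫⁻ θ, ENNReal.ofReal (c t θ) ∂(trainLaw lossT P₀ η JT ST t) := by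
    rw [incoherence, ← ENNReal.rpow_natCast, ← ENNReal.rpow_mul, Nat.cast_ofNat,
      one_div_mul_cancel two_ne_zero, ENNReal.rpow_one]
    exact Finset.sum_congr rfl fun t _ => fisherDist_gibbsDensity_sq hΘ hpos _
      (continuous_empRisk hT ST _) (continuous_empRisk hV SV _)
  have hne : ∑ t ∈ Finset.range T,
      ∫⁻ θ, ENNReal.ofReal (c t θ) ∂(trainLaw lossT P₀ η JT ST t) ≠ ⊤ :=
    hsq ▸ ENNReal.pow_ne_top hfin
  have hterm : ∀ t ∈ Finset.range T,
      ∫⁻ θ, ENNReal.ofReal (c t θ) ∂(trainLaw lossT P₀ η JT ST t) ≠ ⊤ :=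
    fun t ht => (ENNReal.sum_ne_top.1 hne) t ht
  refine ⟨fun t ht => ⟨(hcm t).aestronglyMeasurable, ?_⟩, ?_⟩
  · rw [hasFiniteIntegral_iff_ofReal (.of_forall (hc0 t))]
    exact (hterm t (Finset.mem_range.2 ht)).lt_top
  · rw [← ENNReal.toReal_pow, hsq, ENNReal.toReal_sum hterm]
    exact Finset.sum_congr rfl fun t _ =>
      integral_eq_lintegral_of_nonneg_ae (.of_forall (hc0 t)) (hcm t).aestronglyMeasurable

lemma sqrt_add_le_sqrt_add_sqrt {x y : ℝ} (hx : 0 ≤ x) (hy : 0 ≤ y) : √(x + y) ≤ √x + √y := by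
  refine Real.sqrt_le_iff.2 ⟨by positivity, ?_⟩
  nlinarith [Real.sq_sqrt hx, Real.sq_sqrt hy, Real.sqrt_nonneg x, Real.sqrt_nonneg y]

lemma mismatch_nonneg (T m : ℕ) {nT nV : ℕ} (hnT : 0 < nT) (hnV : 0 < nV) :
    0 ≤ mismatch T m nT nV := by
  have h : (0 : ℝ) < (nV : ℝ) / nT := div_pos (Nat.cast_pos.2 hnV) (Nat.cast_pos.2 hnT)
  have := Real.log_le_sub_one_of_pos h
  exact mul_nonneg (Nat.cast_nonneg _) (mul_nonneg (by positivity) (by linarith))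

/-- Jensen's inequality for the square of the positive part. -/
lemma integral_le_sqrt_of_integral_sq_posPart_le {α : Type*} [MeasurableSpace α] {μ : Measure α}
    [IsProbabilityMeasure μ] {f : α → ℝ} (hf : Measurable f) {M : ℝ} (hM : ∀ x, |f x| ≤ M)
    {A : ℝ} (hA : ∫ x, max (f x) 0 ^ 2 ∂μ ≤ A) : ∫ x, f x ∂μ ≤ √A := by
  have hM0 : ∀ x, |max (f x) 0| ≤ M := fun x => by
    rw [abs_of_nonneg (le_max_right _ _)]
    exact max_le ((le_abs_self _).trans (hM x)) ((abs_nonneg _).trans (hM x))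
  have hi : Integrable (fun x => max (f x) 0) μ :=
    integrable_of_abs_le (hf.max measurable_const) hM0
  have hi2 : Integrable (fun x => max (f x) 0 ^ 2) μ :=
    integrable_of_abs_le ((hf.max measurable_const).pow_const 2) (M := M ^ 2) fun x => by
      rw [abs_pow]
      exact pow_le_pow_left₀ (abs_nonneg _) (hM0 x) 2
  have hJ : (∫ x, max (f x) 0 ∂μ) ^ 2 ≤ ∫ x, max (f x) 0 ^ 2 ∂μ :=
    (even_two.convexOn_pow (𝕜 := ℝ)).map_integral_le (continuous_pow 2).continuousOn isClosed_univ
      (by simp) hi hi2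
  calc ∫ x, f x ∂μ ≤ ∫ x, max (f x) 0 ∂μ :=
        integral_mono (integrable_of_abs_le hf hM) hi fun x => le_max_left _ _
    _ ≤ √A := Real.le_sqrt_of_sq_le (hJ.trans hA)

/-- The deterministic part of the bound: the divergence of the posteriors for a training set on
which the prior average and the posterior average of the generalization gap are not exceptional. -/
lemma posteriorKL_le {Z : Type*} [MeasurableSpace Z] {m nT nV : ℕ} (hnT : 0 < nT) (hnV : 0 < nV)
    (T : ℕ) {Θ : Set (Param m)} (hΘ : IsCompact Θ) (hpos : 0 < volume Θ)
    {lossT lossV : Param m → Z → ℝ} (hmeas : ∀ θ, Measurable (lossT θ))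
    (hbdd : ∀ θ z, lossT θ z ∈ Set.Icc (0 : ℝ) 1) (hV : ∀ z, Continuous fun θ => lossV θ z)
    {γ : ℝ≥0} (hLip : ∀ z, LipschitzWith γ fun θ => lossT θ z)
    (DT : Measure Z) [IsProbabilityMeasure DT] (P₀ : Measure (Param m)) [IsProbabilityMeasure P₀]
    {η : ℝ} (hη : 0 < η) (JT : ℕ → Finset (Fin nT)) (JV : ℕ → Finset (Fin nV))
    (ST : Fin nT → Z) (SV : Fin nV → Z) {κ : ℝ≥0} {Δ : ℝ} (hΔ : 0 < Δ) (hΔ1 : Δ < 1)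
    (hprior : ∫⁻ θ, ENNReal.ofReal (Real.exp
        (2 * nT * max (∫ z, lossT θ z ∂DT - (∑ i, lossT θ (ST i)) / nT) 0 ^ 2))
        ∂(langevinLaw P₀ η nV (fun s => empRisk lossV SV (JV s)) T)
      < ENNReal.ofReal (5 * nT / Δ))
    (hpost : -√(Real.log (5 * nT / Δ) / (2 * nT)) <
      ∫ θ, (expRisk lossT DT θ - empRisk lossT ST Finset.univ θ)
        ∂(gibbs Θ nT (expRisk lossT DT)))
    (hW : wasserstein1 (trainLaw lossT P₀ η JT ST T)
      (gibbs Θ nT (empRisk lossT ST Finset.univ)) ≤ κ) :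
    posteriorKL Θ lossT DT ST ≤
      ENNReal.ofReal (boundSlope η nT nV) * incoherence Θ lossT lossV P₀ η T JT JV ST SV
        + ENNReal.ofReal (boundOffset T m nT nV Δ γ κ) := by
  have hnT' : (0 : ℝ) < nT := Nat.cast_pos.2 hnT
  have hnV' : (0 : ℝ) < nV := Nat.cast_pos.2 hnV
  have hslope : 0 < boundSlope η nT nV := Real.sqrt_pos.2 (by positivity)
  -- An infinite regularizer makes the bound infinite, the slope being positive. Otherwise the score
  -- differences are square integrable and real integrals suffice.
  by_cases htop : incoherence Θ lossT lossV P₀ η T JT JV ST SV = ⊤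
  · rw [htop, ENNReal.mul_top (by simpa using hslope), top_add]
    exact le_top
  have hTc : ∀ z, Continuous fun θ => lossT θ z := fun z => (hLip z).continuous
  obtain ⟨hint, hsum⟩ := incoherence_sq_eq hΘ hpos hTc hV P₀ η T JT JV ST SV htop
  set R : ℝ := (incoherence Θ lossT lossV P₀ η T JT JV ST SV).toReal
  have hR0 : 0 ≤ R := ENNReal.toReal_nonneg
  set ν := trainLaw lossT P₀ η JT ST T with hν
  have hνp : IsProbabilityMeasure ν := isProbabilityMeasure_langevinLaw P₀ η nT _ T
  have hcR : Continuous (expRisk lossT DT) := continuous_expRisk DT hmeas hbdd hLip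
  have hcE : Continuous (empRisk lossT ST Finset.univ) := continuous_empRisk hTc ST _
  have hPSp := isProbabilityMeasure_gibbs hΘ hpos nT hcE
  set gap : Param m → ℝ := fun θ => expRisk lossT DT θ - empRisk lossT ST Finset.univ θ with hgap
  have hgc : Continuous gap := hcR.sub hcE
  have hgap1 : ∀ θ, |gap θ| ≤ 1 := fun θ => by
    have h1 : expRisk lossT DT θ ∈ Set.Icc (0 : ℝ) 1 := integral_mem_Icc DT (hbdd θ)
    have h2 := average_mem_Icc hnT fun i => hbdd θ (ST i)
    rw [← empRisk_univ ST θ] at h2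
    exact abs_sub_le_iff.2 ⟨by linarith [h1.2, h2.1], by linarith [h1.1, h2.2]⟩
  set L : ℝ := Real.log (5 * nT / Δ) with hL
  have hq : 1 < 5 * nT / Δ := by
    rw [lt_div_iff₀ hΔ]
    have : (1 : ℝ) ≤ nT := Nat.one_le_cast.2 hnT
    linarith
  have hL0 : 0 < L := Real.log_pos hq
  have hB := mismatch_nonneg T m hnT hnV
  -- PAC-Bayes for the law of the last iterate
  set g : Param m → ℝ := fun θ => 2 * nT * max (gap θ) 0 ^ 2 with hg
  have hgm : Measurable g := by fun_prop
  have hgM : ∀ θ, |g θ| ≤ 2 * nT := fun θ => by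
    have h1 : max (gap θ) 0 ≤ 1 := max_le ((le_abs_self _).trans (hgap1 θ)) zero_le_one
    have h2 : max (gap θ) 0 ^ 2 ≤ 1 := pow_le_one₀ (le_max_right _ _) h1
    rw [abs_of_nonneg (by positivity)]
    nlinarith
  have hDV := integral_langevinLaw_le_log_integral_exp P₀ hη hnT hnV
    (fun s => empRisk lossT ST (JT s)) (fun s => empRisk lossV SV (JV s)) T hint hgm hgM
  set π := langevinLaw P₀ η nV (fun s => empRisk lossV SV (JV s)) T with hπ
  have hlog : Real.log (∫ θ, Real.exp (g θ) ∂π) ≤ L := by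
    have hi : Integrable (fun θ => Real.exp (g θ)) π := integrable_exp_of_abs_le hgm hgM
    refine Real.log_le_log (integral_exp_pos hi) ?_
    rw [← ENNReal.ofReal_le_ofReal_iff (by positivity),
      ofReal_integral_eq_lintegral_ofReal hi (.of_forall fun θ => (Real.exp_pos _).le)]
    refine le_trans (le_of_eq ?_) hprior.le
    simp only [hg, hgap, empRisk_univ, expRisk]
  have hDV' : ∫ θ, g θ ∂ν ≤ L + mismatch T m nT nV + η * nV / 4 * R ^ 2 :=
    hDV.trans (add_le_add (add_le_add hlog le_rfl)
      (mul_le_mul_of_nonneg_left hsum.le (by positivity)))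
  have hsq : ∫ θ, max (gap θ) 0 ^ 2 ∂ν
      ≤ η * nV / (8 * nT) * R ^ 2 + (mismatch T m nT nV + L) / (2 * nT) := by
    simp only [hg] at hDV'
    rw [integral_const_mul, ← le_div_iff₀' (by positivity)] at hDV'
    refine hDV'.trans_eq ?_
    field_simp
    ring
  have hν1 : ∫ θ, gap θ ∂ν ≤ √(η * nV / (8 * nT)) * R + √((mismatch T m nT nV + L) / (2 * nT)) := by
    refine (integral_le_sqrt_of_integral_sq_posPart_le hgc.measurable hgap1 hsq).trans ?_
    refine (sqrt_add_le_sqrt_add_sqrt (by positivity) (by positivity)).trans_eq ?_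
    rw [Real.sqrt_mul (by positivity), Real.sqrt_sq hR0]
  -- transfer to the posterior
  have hLipgap := lipschitzWith_expRisk_sub_empRisk DT hnT hmeas hbdd hLip ST
  have hW' := integral_le_add_of_wasserstein1_le hW hLipgap
    (integrable_of_abs_le hgc.measurable hgap1) (integrable_of_abs_le hgc.measurable hgap1)
  -- `8 n_T` is `4 · 2 n_T`: the drift cost `η n_V / 4` divided by the exponent factor `2 n_T` in
  -- `g`.
  have hslope_eq : nT * √(η * nV / (8 * nT)) = boundSlope η nT nV := by
    rw [boundSlope, ← Real.sqrt_sq hnT'.le, ← Real.sqrt_mul (by positivity), Real.sqrt_sq hnT'.le]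
    congr 1
    field_simp
  refine (klDiv_gibbs_le hΘ hpos nT hcE hcR).trans ?_
  rw [← ENNReal.ofReal_toReal htop, ← ENNReal.ofReal_mul hslope.le, ← ENNReal.ofReal_add
    (by positivity) (by unfold boundOffset; positivity)]
  refine ENNReal.ofReal_le_ofReal ?_
  have hfinal : ∫ θ, gap θ ∂(gibbs Θ nT (empRisk lossT ST Finset.univ))
      - ∫ θ, gap θ ∂(gibbs Θ nT (expRisk lossT DT))
      ≤ √(η * nV / (8 * nT)) * R + (√((mismatch T m nT nV + L) / (2 * nT))
        + √(L / (2 * nT)) + 2 * γ * κ) := by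
    push_cast at hW'
    linarith
  calc _ ≤ nT * (√(η * nV / (8 * nT)) * R + (√((mismatch T m nT nV + L) / (2 * nT))
        + √(L / (2 * nT)) + 2 * γ * κ)) := mul_le_mul_of_nonneg_left hfinal hnT'.le
    _ = _ := by rw [mul_add, ← mul_assoc, hslope_eq, boundOffset]

/-! ### Equivalence of the minimizations, and the theorem. -/

lemma isMinOn_const_mul_add_const_iff {Λ : Type*} {f : Λ → ℝ≥0∞} {A : Set Λ} {l : Λ} {a b : ℝ≥0∞}
    (ha : a ≠ 0) (ha' : a ≠ ⊤) (hb : b ≠ ⊤) :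
    IsMinOn f A l ↔ IsMinOn (fun l' => a * f l' + b) A l := by
  simp only [isMinOn_iff, ENNReal.add_le_add_iff_right hb, ENNReal.mul_le_mul_iff_right ha ha']

theorem corollary2
    {𝒳 𝒴 Λ : Type*} [MeasurableSpace 𝒳] [MeasurableSpace 𝒴]
    {m nT nV : ℕ} (hnT : 0 < nT) (hnV : 0 < nV) (T : ℕ)
    -- compact parameter sets and the training and validation losses, per hyperparameter
    (Θ : Λ → Set (Param m)) (hΘ : ∀ l, IsCompact (Θ l)) (hΘpos : ∀ l, 0 < volume (Θ l))
    (lossT lossV : Λ → Param m → 𝒳 × 𝒴 → ℝ)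
    (hmeas : ∀ l θ, Measurable (lossT l θ))
    (hbdd : ∀ l θ z, lossT l θ z ∈ Set.Icc (0 : ℝ) 1)
    (hdiffT : ∀ l z, Differentiable ℝ fun θ => lossT l θ z)
    (hdiffV : ∀ l z, Differentiable ℝ fun θ => lossV l θ z)
    (γ : ℝ≥0) (hLip : ∀ l z, LipschitzWith γ fun θ => lossT l θ z)
    -- the data distribution, the initial law, the step size and the mini-batch schedules
    (DT : Measure (𝒳 × 𝒴)) [IsProbabilityMeasure DT]
    (P₀ : Measure (Param m)) [IsProbabilityMeasure P₀] (η : ℝ) (hη : 0 < η)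
    (JT : ℕ → Finset (Fin nT)) (hJT : ∀ t, (JT t).Nonempty)
    (JV : ℕ → Finset (Fin nV)) (hJV : ∀ t, (JV t).Nonempty)
    -- the validation set, the Wasserstein tolerance and the failure probability
    (SV : Fin nV → 𝒳 × 𝒴) (κ : ℝ≥0) (Δ : ℝ) (hΔ : 0 < Δ) (hΔ1 : Δ < 1) :
    -- for each hyperparameter, with probability at least `1 - Δ` over the training set:
    -- if the sampler is `κ`-converged, then the posterior divergence is at most the bound
    (∀ l : Λ,
      (Measure.pi fun _ : Fin nT => DT)
        {ST | ¬ (wasserstein1 (trainLaw (lossT l) P₀ η JT ST T)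
                    (gibbs (Θ l) nT (empRisk (lossT l) ST Finset.univ)) ≤ κ →
                  posteriorKL (Θ l) (lossT l) DT ST ≤
                    ENNReal.ofReal (boundSlope η nT nV) *
                        incoherence (Θ l) (lossT l) (lossV l) P₀ η T JT JV ST SV
                      + ENNReal.ofReal (boundOffset T m nT nV Δ γ κ))}
        ≤ ENNReal.ofReal Δ) ∧
    -- minimizing the regularizer is the same as minimizing the bound
    (∀ (ST : Fin nT → 𝒳 × 𝒴) (A : Set Λ) (l : Λ),
      IsMinOn (fun l' => incoherence (Θ l') (lossT l') (lossV l') P₀ η T JT JV ST SV) A l ↔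
        IsMinOn (fun l' =>
          ENNReal.ofReal (boundSlope η nT nV) *
              incoherence (Θ l') (lossT l') (lossV l') P₀ η T JT JV ST SV
            + ENNReal.ofReal (boundOffset T m nT nV Δ γ κ)) A l) := by
  have hnT' : (0 : ℝ) < nT := Nat.cast_pos.2 hnT
  have hnV' : (0 : ℝ) < nV := Nat.cast_pos.2 hnV
  have hnT1 : (1 : ℝ) ≤ nT := Nat.one_le_cast.2 hnT
  have hslope : 0 < boundSlope η nT nV := Real.sqrt_pos.2 (by positivity)
  refine ⟨fun l => ?_, fun ST A l => isMinOn_const_mul_add_const_iff (by simpa using hslope)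
    ENNReal.ofReal_ne_top ENNReal.ofReal_ne_top⟩
  -- The exceptional events have probability at most `(1 + 2 n_T) / c` and `1 / c`. Their sum is `(2
  -- + 2 n_T) Δ / (5 n_T) ≤ Δ`, as `n_T ≥ 1`.
  set c : ℝ := 5 * nT / Δ with hc
  have hc0 : 0 < c := by positivity
  have hc1 : 1 < c := by
    rw [hc, lt_div_iff₀ hΔ]
    linarith
  have hlog := Real.log_pos hc1
  set ε : ℝ := √(Real.log c / (2 * nT)) with hε
  have hloss := measurable_uncurry_loss (hmeas l) (hLip l)
  have hcR : Continuous (expRisk (lossT l) DT) := continuous_expRisk DT (hmeas l) (hbdd l) (hLip l)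
  set PD := gibbs (Θ l) nT (expRisk (lossT l) DT) with hPD
  have hPDp : IsProbabilityMeasure PD := isProbabilityMeasure_gibbs (hΘ l) (hΘpos l) nT hcR
  -- the loss averaged over the data-independent posterior, reflected
  set f : 𝒳 × 𝒴 → ℝ := fun z => 1 - ∫ θ, lossT l θ z ∂PD with hf
  have hswap : Measurable (Function.uncurry fun z θ => lossT l θ z) := hloss.comp measurable_swap
  have hfm : Measurable f :=
    measurable_const.sub hswap.stronglyMeasurable.integral_prod_right.measurable
  have hf01 : ∀ z, f z ∈ Set.Icc (0 : ℝ) 1 := fun z => by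
    have h := integral_mem_Icc PD fun θ => hbdd l θ z
    exact ⟨by linarith [h.2], by linarith [h.1]⟩
  have hfi : Integrable (fun z => ∫ θ, lossT l θ z ∂PD) DT := by
    refine (integrable_const (1 : ℝ)).sub (integrable_of_abs_le (μ := DT) hfm (M := 1) fun z =>
      abs_le.2 ⟨by linarith [(hf01 z).1], (hf01 z).2⟩) |>.congr (.of_forall fun z => ?_)
    simp [hf]
  have h1 := measure_pi_lintegral_exp_sq_gap_ge_le DT hnT
    (langevinLaw P₀ η nV (fun s => empRisk (lossV l) SV (JV s)) T) hloss (hbdd l) hc0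
  -- Passing from the loss to one minus the loss changes the sign of the gap, so the upper-tail
  -- bound controls the lower tail. At `ε` it equals `1 / c`.
  have h2 := measure_pi_le_integral_sub_average_le DT hnT hfm hf01 (Real.sqrt_nonneg _ : 0 ≤ ε)
  rw [Real.sq_sqrt (by positivity), mul_div_cancel₀ _ (by positivity), Real.exp_neg,
    Real.exp_log hc0, ← hε] at h2
  -- Monotonicity and subadditivity hold for arbitrary sets, so measurability of the failure event
  -- is not needed.
  refine (measure_mono fun ST hST => ?_).trans ((measure_union_le _ _).trans
    ((add_le_add h1 h2).trans ?_))
  · by_contra hnot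
    rw [Set.mem_union, not_or] at hnot
    refine hST fun hW => posteriorKL_le hnT hnV T (hΘ l) (hΘpos l) (hmeas l) (hbdd l)
      (fun z => (hdiffV l z).continuous) (hLip l) DT P₀ hη JT JV ST SV hΔ hΔ1
      (not_le.1 hnot.1) ?_ hW
    have h3 : ∫ z, f z ∂DT - (∑ i, f (ST i)) / nT < ε := not_le.1 hnot.2
    have h4 : ∫ z, f z ∂DT = 1 - ∫ z, ∫ θ, lossT l θ z ∂PD ∂DT := by
      rw [hf, integral_sub (integrable_const _) hfi]
      simp
    have h5 : (∑ i, f (ST i)) / nT = 1 - (∑ i, ∫ θ, lossT l θ (ST i) ∂PD) / nT := by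
      simp only [hf, Finset.sum_sub_distrib, Finset.sum_const, Finset.card_univ, Fintype.card_fin,
        nsmul_eq_mul, mul_one, sub_div, div_self hnT'.ne']
    rw [integral_expRisk_sub_empRisk DT PD hloss (hbdd l) ST]
    rw [h4, h5] at h3
    linarith
  · rw [← ENNReal.ofReal_add (by positivity) (by positivity)]
    refine ENNReal.ofReal_le_ofReal ?_
    rw [hc, inv_div, div_div_eq_mul_div, ← add_div, div_le_iff₀ (by positivity)]
    nlinarith
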